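/- Let $d\ge 2$. For $A\subset\mathbb R^d$ open and bounded, $y:\bar A\to\mathbb R^d$ continuous and $z\in\mathbb R^d\setminus y(\partial A)$, let $\deg(y;A;z)\in\mathbb Z$ denote the Brouwer degree. Let $\Omega\subset\mathbb R^d$ be open, let $\mathcal O$ be the family of all open sets $A$ whose closure $\bar A$ is compact and contained in $\Omega$, and let $y:\Omega\to\mathbb R^d$ be continuous and *strictly orientation preserving*, i.e., - for every non-empty $V\in\mathcal O$ there are $A\in\mathcal O$ with $A\subset V$ and $z\in\mathbb R^d\setminus y(\partial A)$ such that $\deg(y;A;z)\neq 0$, and - $\deg(y;A;z)\ge 0$ for all $A\in\mathcal O$ and all $z\in\mathbb R^d\setminus y(\partial A)$. For $V\subset\Omega$ open (such that, in the first line, $V$ is bounded and $y$ is defined and continuous on $\bar V$) let $$\operatorname{im}_T(y;V):=\{z\in\mathbb R^d\setminus y(\partial V) : \deg(y;V;z)\neq 0\},$$ $$\operatorname{im}_{\mathrm{loc}}(y;V):=\bigcup_{A\in\mathcal O,\,A\subset V}\operatorname{im}_T(y;A),$$ $$\mathcal R_y(V):=\{x\in V : \text{there is } A\in\mathcal O \text{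 with } x\in A\subset V \text{ and } y(x)\notin y(\partial A)\}.$$ Let either $U\in\mathcal O$, or else $U=\Omega$, where in the latter case $\Omega$ is bounded and $y$ is extended continuously to $\bar\Omega$. Assume that $\deg(y;U;z)\le 1$ for all $z\in\mathbb R^d\setminus y(\partial U)$, and that $\operatorname{int} y(\partial U)=\emptyset$. Then $$\operatorname{int}K=\emptyset\ \Longrightarrow\ \operatorname{int}y(K)=\emptyset\qquad\text{for every compact } K\subset\bar U .$$ In particular, for every open and bounded $\tilde U\subset U$ with $\operatorname{int}\partial\tilde U=\emptyset$ we have $\operatorname{int} y(\partial\tilde U)=\emptyset$ and the following: - (i) For every $A\in\mathcal O$ with $A\subset\tilde U$: $\deg(y;A;\cdot)\ge 1$ on $y(A)\setminus y(\partial A)$, $\deg(y;A;\cdot)\le 1$ on $y(A)\setminus[y(\partial A)\cup y(\partial\tilde U)]$, and in fact $\deg(y;A;\cdot)=1$ on $y(A)\setminus y(\partial A)$. - (iii) $\operatorname{im}_{\mathrm{loc}}(y;\tilde U)\cap y(\partial\tilde U)=\emptyset$, $\ \mathcal R_y(\tilde U)=\tilde U\setminus y^{-1}(y(\partial\tilde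 U))$, $\ \operatorname{im}_{\mathrm{loc}}(y;\tilde U)=y(\tilde U)\setminus y(\partial\tilde U)=\operatorname{im}_T(y;\tilde U)$, and $\ y(\partial\tilde U)=\partial\big(\operatorname{im}_{\mathrm{loc}}(y;\tilde U)\big)$. -/

import Mathlib

open scoped ContDiff

/-! ### Brouwer degree in `ℝ^d` -/

noncomputable section

/-- The sum of the signs of the Jacobian determinants of `f` over the points of `A` which `f`
maps to `z`. It is a finite sum as soon as `A` is bounded, `z ∉ f (∂A)` and `z` is a regular
value of the smooth map `f` on `A`. -/
def signSum {d : ℕ} (f : EuclideanSpace ℝ (Fin d) → EuclideanSpace ℝ (Fin d))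
    (A : Set (EuclideanSpace ℝ (Fin d))) (z : EuclideanSpace ℝ (Fin d)) : ℤ :=
  ∑ᶠ x ∈ {x | x ∈ A ∧ f x = z}, (SignType.sign (fderiv ℝ f x).det : ℤ)

/-- `f` is a regular approximation of `y` on `A` with respect to the value `z`:
`f` is smooth, `z` is a regular value of `f` on `A`, and `‖f - y‖` on the closure of `A` is
smaller than the distance of `z` to `y (∂A)`. -/
def IsRegularApprox {d : ℕ} (y : EuclideanSpace ℝ (Fin d) → EuclideanSpace ℝ (Fin d))
    (A : Set (EuclideanSpace ℝ (Fin d))) (z : EuclideanSpace ℝ (Fin d))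
    (f : EuclideanSpace ℝ (Fin d) → EuclideanSpace ℝ (Fin d)) : Prop :=
  ContDiff ℝ ∞ f ∧
    (∀ x ∈ closure A, ∀ w ∈ frontier A, dist (f x) (y x) < dist z (y w)) ∧
    ∀ x ∈ A, f x = z → (fderiv ℝ f x).det ≠ 0

open Classical in
/-- The Brouwer degree `deg (y; A; z)`, for `A` open and bounded, `y` continuous on the closure
of `A` and `z ∉ y (∂A)`: the signed number of solutions in `A` of `f x = z`, for a
regular approximation `f` of `y`. (Regular approximations always exist for such `y`, `A`, `z`,
and all of them give the same number. The value `0` in the remaining case is never used.) -/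
def brouwerDeg {d : ℕ} (y : EuclideanSpace ℝ (Fin d) → EuclideanSpace ℝ (Fin d))
    (A : Set (EuclideanSpace ℝ (Fin d))) (z : EuclideanSpace ℝ (Fin d)) : ℤ :=
  if h : ∃ f, IsRegularApprox y A z f then signSum h.choose A z else 0

/-! ### Orientation preserving maps -/

/-- The family of all open sets which are compactly contained in `Ω`. -/
def openCC {d : ℕ} (Ω : Set (EuclideanSpace ℝ (Fin d))) :
    Set (Set (EuclideanSpace ℝ (Fin d))) :=
  {A | IsOpen A ∧ IsCompact (closure A) ∧ closure A ⊆ Ω}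

/-- `y` is non-degenerate on `Ω`. -/
def NonDegenerate {d : ℕ} (Ω : Set (EuclideanSpace ℝ (Fin d)))
    (y : EuclideanSpace ℝ (Fin d) → EuclideanSpace ℝ (Fin d)) : Prop :=
  ∀ U ∈ openCC Ω, U.Nonempty →
    ∃ A ∈ openCC Ω, A ⊆ U ∧ ∃ z, z ∉ y '' frontier A ∧ brouwerDeg y A z ≠ 0

/-- `y` is orientation preserving on `Ω`. -/
def OrientationPreserving {d : ℕ} (Ω : Set (EuclideanSpace ℝ (Fin d)))
    (y : EuclideanSpace ℝ (Fin d) → EuclideanSpace ℝ (Fin d)) : Prop :=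
  ∀ A ∈ openCC Ω, ∀ z, z ∉ y '' frontier A → 0 ≤ brouwerDeg y A z

/-- `y` is strictly orientation preserving on `Ω`. -/
def StrictlyOrientationPreserving {d : ℕ} (Ω : Set (EuclideanSpace ℝ (Fin d)))
    (y : EuclideanSpace ℝ (Fin d) → EuclideanSpace ℝ (Fin d)) : Prop :=
  NonDegenerate Ω y ∧ OrientationPreserving Ω y

/-! ### Topological images and the reduced domain -/

/-- The topological image `im_T (y; A)`. -/
def imT {d : ℕ} (y : EuclideanSpace ℝ (Fin d) → EuclideanSpace ℝ (Fin d))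
    (A : Set (EuclideanSpace ℝ (Fin d))) : Set (EuclideanSpace ℝ (Fin d)) :=
  {z | z ∉ y '' frontier A ∧ brouwerDeg y A z ≠ 0}

/-- The localized topological image `im_loc (y; U)`: the union of the topological images of all
open `A ⊆ U` which are compactly contained in `Ω`. -/
def imLoc {d : ℕ} (Ω : Set (EuclideanSpace ℝ (Fin d)))
    (y : EuclideanSpace ℝ (Fin d) → EuclideanSpace ℝ (Fin d))
    (U : Set (EuclideanSpace ℝ (Fin d))) : Set (EuclideanSpace ℝ (Fin d)) :=
  {z | ∃ A ∈ openCC Ω, A ⊆ U ∧ z ∈ imT y A}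

/-- The topologically reduced domain `R_y (U)`. -/
def reducedDomain {d : ℕ} (Ω : Set (EuclideanSpace ℝ (Fin d)))
    (y : EuclideanSpace ℝ (Fin d) → EuclideanSpace ℝ (Fin d))
    (U : Set (EuclideanSpace ℝ (Fin d))) : Set (EuclideanSpace ℝ (Fin d)) :=
  {x | x ∈ U ∧ ∃ A ∈ openCC Ω, x ∈ A ∧ A ⊆ U ∧ y x ∉ y '' frontier A}

end

/-! The core is a counting argument. The degree is nonnegative, additive over disjoint open sets and
locally constant in the value, so a degree of at most 1 on `U` forbids two disjoint open subsets of
`U` to have positive degree at a common value (`false_of_disjoint`). Positive degree is abundant: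
non-degeneracy provides it near every point, and monotonicity in the domain spreads it to every
attained value off the image of the boundary (`one_le`). Values in `y '' frontier U` are dodged by
small perturbations, since that set has empty interior.

Suppose `y '' K` contains a nonempty open set `N` although `K` has empty interior. Then some open
`A` off `K` has positive degree at a value in `N`. After a perturbation this value is also attained
at a point of `K`, which lies outside `closure A`, so `U \ closure A` has positive degree there too:
a contradiction. Likewise, a value of positive degree on `A ⊆ V` cannot be attained on `frontier V`,
because points of `V` outside `closure A` would take nearby values. Part (iii) rests on this.

Since the degree is a signed count for a chosen smooth approximation, its independence of the choice
has to be proved. The count equals the integral of `φ (f) * det (Df)` over `A` for a bump `φ`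
concentrated at `z`, and this integral is invariant under homotopy because the Jacobian determinant
is a null Lagrangian. -/

open MeasureTheory Metric Set Filter Topology

/-! ### The Jacobian determinant as a null Lagrangian -/

section NullLagrangian

variable {d : ℕ}

/-- The Jacobian matrix of a tuple of scalar functions; the rows are the gradients. -/
noncomputable def jacobianMatrix (u : Fin d → EuclideanSpace ℝ (Fin d) → ℝ)
    (x : EuclideanSpace ℝ (Fin d)) : Matrix (Fin d) (Fin d) ℝ :=
  Matrix.of fun i k => fderiv ℝ (u i) x (EuclideanSpace.single k 1)

theorem contDiff_fderiv_apply_const {u : EuclideanSpace ℝ (Fin d) → ℝ} (hu : ContDiff ℝ ∞ u)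
    (v : EuclideanSpace ℝ (Fin d)) : ContDiff ℝ ∞ fun x => fderiv ℝ u x v :=
  (hu.fderiv_right (m := ∞) (by simp)).clm_apply contDiff_const

theorem fderiv_fderiv_apply_comm {u : EuclideanSpace ℝ (Fin d) → ℝ} (hu : ContDiff ℝ ∞ u)
    (x v w : EuclideanSpace ℝ (Fin d)) :
    fderiv ℝ (fun y => fderiv ℝ u y v) x w = fderiv ℝ (fun y => fderiv ℝ u y w) x v := by
  have hd : DifferentiableAt ℝ (fderiv ℝ u) x :=
    ((hu.fderiv_right (m := ∞) (by simp)).differentiable (by simp)) x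
  have h : ∀ v w, fderiv ℝ (fun y => fderiv ℝ u y v) x w = fderiv ℝ (fderiv ℝ u) x w v := by
    intro v w
    rw [fderiv_clm_apply hd (differentiableAt_const v)]
    simp
  rw [h, h]
  exact (hu.contDiffAt.isSymmSndFDerivAt
    (by simpa using WithTop.coe_le_coe.2 (le_top : (2 : ℕ∞) ≤ ⊤))) w v

/-- Piola's identity: the cofactor row belonging to `u j` is divergence free. Each term contains a
second derivative of some `u k` in the directions `σ k` and `σ j`. Composing `σ` with `swap j k`
exchanges the two directions, harmless by symmetry, and flips the sign, so the sum equals its own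
negative. -/
theorem sum_sign_mul_fderiv_prod_eq_zero {u : Fin d → EuclideanSpace ℝ (Fin d) → ℝ}
    (hu : ∀ i, ContDiff ℝ ∞ (u i)) (j : Fin d) (x : EuclideanSpace ℝ (Fin d)) :
    ∑ σ : Equiv.Perm (Fin d), ((Equiv.Perm.sign σ : ℤ) : ℝ) *
      fderiv ℝ (fun y => ∏ i ∈ Finset.univ.erase j,
        fderiv ℝ (u i) y (EuclideanSpace.single (σ i) 1)) x (EuclideanSpace.single (σ j) 1) = 0 := by
  have hprod : ∀ σ : Equiv.Perm (Fin d), fderiv ℝ (fun y => ∏ i ∈ Finset.univ.erase j,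
        fderiv ℝ (u i) y (EuclideanSpace.single (σ i) 1)) x (EuclideanSpace.single (σ j) 1) =
      ∑ k ∈ Finset.univ.erase j, (∏ i ∈ (Finset.univ.erase j).erase k,
        fderiv ℝ (u i) x (EuclideanSpace.single (σ i) 1)) *
        fderiv ℝ (fun y => fderiv ℝ (u k) y (EuclideanSpace.single (σ k) 1)) x
          (EuclideanSpace.single (σ j) 1) := by
    intro σ
    rw [(HasFDerivAt.finsetProd (u := Finset.univ.erase j) fun i _ =>
      ((contDiff_fderiv_apply_const (hu i) (EuclideanSpace.single (σ i) 1)).differentiable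
        (by simp) x).hasFDerivAt).fderiv]
    simp
  simp_rw [hprod, Finset.mul_sum]
  rw [Finset.sum_comm]
  refine Finset.sum_eq_zero fun k hk => ?_
  have hkj : k ≠ j := Finset.ne_of_mem_erase hk
  rw [← self_eq_neg]
  conv_lhs => rw [← Equiv.sum_comp (Equiv.mulRight (Equiv.swap j k))]
  rw [← Finset.sum_neg_distrib]
  refine Finset.sum_congr rfl fun σ _ => ?_
  have hrest : ∏ i ∈ (Finset.univ.erase j).erase k,
      fderiv ℝ (u i) x (EuclideanSpace.single ((σ * Equiv.swap j k) i) 1) =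
      ∏ i ∈ (Finset.univ.erase j).erase k,
        fderiv ℝ (u i) x (EuclideanSpace.single (σ i) 1) := by
    refine Finset.prod_congr rfl fun i hi => ?_
    have h1 : i ≠ k := Finset.ne_of_mem_erase hi
    have h2 : i ≠ j := Finset.ne_of_mem_erase (Finset.mem_of_mem_erase hi)
    rw [Equiv.Perm.mul_apply, Equiv.swap_apply_of_ne_of_ne h2 h1]
  simp only [Equiv.coe_mulRight, hrest]
  rw [Equiv.Perm.mul_apply, Equiv.Perm.mul_apply, Equiv.swap_apply_left, Equiv.swap_apply_right,
    fderiv_fderiv_apply_comm (hu k) x, Equiv.Perm.sign_mul, Equiv.Perm.sign_swap hkj.symm]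
  push_cast
  ring

/-- The Jacobian determinant is a null Lagrangian. -/
theorem integral_det_jacobianMatrix_eq_zero {u : Fin d → EuclideanSpace ℝ (Fin d) → ℝ}
    (hu : ∀ i, ContDiff ℝ ∞ (u i)) (j : Fin d) (hj : HasCompactSupport (u j)) :
    ∫ x, (jacobianMatrix u x).det = 0 := by
  set P : Equiv.Perm (Fin d) → EuclideanSpace ℝ (Fin d) → ℝ := fun σ y =>
    ∏ i ∈ Finset.univ.erase j, fderiv ℝ (u i) y (EuclideanSpace.single (σ i) 1) with hP
  have hPs : ∀ σ, ContDiff ℝ ∞ (P σ) := fun σ =>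
    contDiff_prod fun i _ => contDiff_fderiv_apply_const (hu i) _
  have hdet : ∀ x, (jacobianMatrix u x).det = ∑ σ : Equiv.Perm (Fin d),
      ((Equiv.Perm.sign σ : ℤ) : ℝ) *
        (P σ x * fderiv ℝ (u j) x (EuclideanSpace.single (σ j) 1)) := by
    intro x
    rw [← Matrix.det_transpose, Matrix.det_apply']
    refine Finset.sum_congr rfl fun σ _ => ?_
    rw [mul_comm (P σ x), hP, Finset.mul_prod_erase Finset.univ
      (fun i => fderiv ℝ (u i) x (EuclideanSpace.single (σ i) 1)) (Finset.mem_univ j)]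
    rfl
  have hcs : ∀ v, HasCompactSupport fun x => fderiv ℝ (u j) x v := fun v =>
    hj.fderiv_apply ℝ v
  have hint1 : ∀ σ v, Integrable fun x => P σ x * fderiv ℝ (u j) x v := fun σ v =>
    ((hPs σ).continuous.mul
      (contDiff_fderiv_apply_const (hu j) v).continuous).integrable_of_hasCompactSupport
        ((hcs v).mul_left)
  have hint2 : ∀ σ v, Integrable fun x => fderiv ℝ (P σ) x v * u j x := fun σ v =>
    ((contDiff_fderiv_apply_const (hPs σ) v).continuous.mul
      (hu j).continuous).integrable_of_hasCompactSupport hj.mul_left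
  have hint3 : ∀ σ, Integrable fun x => P σ x * u j x := fun σ =>
    ((hPs σ).continuous.mul (hu j).continuous).integrable_of_hasCompactSupport hj.mul_left
  simp_rw [hdet]
  rw [integral_finsetSum _ fun σ _ => (hint1 σ _).const_mul _]
  -- The derivative is moved off the compactly supported component; what remains is `u j` times the
  -- divergence of a cofactor row.
  have hparts : ∀ σ : Equiv.Perm (Fin d), ∫ x, ((Equiv.Perm.sign σ : ℤ) : ℝ) *
      (P σ x * fderiv ℝ (u j) x (EuclideanSpace.single (σ j) 1)) =
      ∫ x, -(((Equiv.Perm.sign σ : ℤ) : ℝ) *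
        (fderiv ℝ (P σ) x (EuclideanSpace.single (σ j) 1) * u j x)) := by
    intro σ
    rw [integral_const_mul, integral_mul_fderiv_eq_neg_fderiv_mul_of_integrable (hint2 σ _)
      (hint1 σ _) (hint3 σ) (fun x _ => (hPs σ).differentiable (by simp) x)
      (fun x _ => (hu j).differentiable (by simp) x), integral_neg, integral_const_mul, mul_neg]
  simp_rw [hparts]
  rw [← integral_finsetSum _ fun σ _ => by simpa using! ((hint2 σ _).const_mul _).neg]
  rw [← integral_zero (EuclideanSpace ℝ (Fin d)) ℝ]
  congr 1
  ext x
  have := sum_sign_mul_fderiv_prod_eq_zero hu j x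
  rw [Finset.sum_neg_distrib]
  simp_rw [← mul_assoc]
  rw [← Finset.sum_mul, this]
  simp

end NullLagrangian

/-! ### Homotopy invariance of the degree integral -/

section Homotopy

variable {d : ℕ}

theorem Matrix.hasDerivAt_det_add_smul (A B : Matrix (Fin d) (Fin d) ℝ) (t : ℝ) :
    HasDerivAt (fun s : ℝ => (A + s • B).det)
      (∑ j, ((A + t • B).updateRow j (B j)).det) t := by
  let D : ContinuousMultilinearMap ℝ (fun _ : Fin d => Fin d → ℝ) ℝ :=
    { (Matrix.detRowAlternating (n := Fin d) (R := ℝ)).toMultilinearMap with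
      cont := Continuous.matrix_det (A := fun M : Fin d → Fin d → ℝ => Matrix.of M) continuous_id }
  have hlin : HasDerivAt (fun s : ℝ => (fun i => A i + s • B i : Fin d → Fin d → ℝ))
      (fun i => B i) t := by
    rw [hasDerivAt_pi]
    intro i
    simpa using ((hasDerivAt_id t).smul_const (B i)).const_add (A i)
  have h := (D.hasFDerivAt (fun i => A i + t • B i)).comp_hasDerivAt t hlin
  rw [ContinuousMultilinearMap.linearDeriv_apply] at h
  exact h

theorem EuclideanSpace.continuousLinearMap_apply_eq_sum
    (L : EuclideanSpace ℝ (Fin d) →L[ℝ] ℝ) (v : EuclideanSpace ℝ (Fin d)) :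
    L v = ∑ i, L (EuclideanSpace.single i 1) * v i := by
  conv_lhs => rw [← (EuclideanSpace.basisFun (Fin d) ℝ).sum_repr v]
  simp [mul_comm]

theorem fderiv_euclidean_apply {f : EuclideanSpace ℝ (Fin d) → EuclideanSpace ℝ (Fin d)}
    {x : EuclideanSpace ℝ (Fin d)} (hf : DifferentiableAt ℝ f x) (i : Fin d)
    (v : EuclideanSpace ℝ (Fin d)) :
    fderiv ℝ (fun y => f y i) x v = fderiv ℝ f x v i := by
  have h := ((EuclideanSpace.proj (𝕜 := ℝ) i).hasFDerivAt (x := f x)).comp x hf.hasFDerivAt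
  have h2 : HasFDerivAt (fun y => f y i) ((EuclideanSpace.proj (𝕜 := ℝ) i).comp (fderiv ℝ f x)) x :=
    h
  rw [h2.fderiv]
  rfl

theorem det_fderiv_eq_det_jacobianMatrix
    {f : EuclideanSpace ℝ (Fin d) → EuclideanSpace ℝ (Fin d)}
    {x : EuclideanSpace ℝ (Fin d)} (hf : DifferentiableAt ℝ f x) :
    (fderiv ℝ f x).det = (jacobianMatrix (fun i y => f y i) x).det := by
  rw [ContinuousLinearMap.det,
    ← LinearMap.det_toMatrix (EuclideanSpace.basisFun (Fin d) ℝ).toBasis]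
  congr 1
  ext i k
  simp [LinearMap.toMatrix_apply, jacobianMatrix, fderiv_euclidean_apply hf]

theorem jacobianMatrix_add_smul {f h : EuclideanSpace ℝ (Fin d) → EuclideanSpace ℝ (Fin d)}
    {x : EuclideanSpace ℝ (Fin d)} (hf : DifferentiableAt ℝ f x) (hh : DifferentiableAt ℝ h x)
    (t : ℝ) :
    jacobianMatrix (fun i y => (f y + t • h y) i) x =
      jacobianMatrix (fun i y => f y i) x + t • jacobianMatrix (fun i y => h y i) x := by
  ext i k
  have hd : DifferentiableAt ℝ (fun y => f y + t • h y) x := hf.add (hh.const_smul t)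
  simp only [jacobianMatrix, Matrix.of_apply, Matrix.add_apply, Matrix.smul_apply]
  have hfd : fderiv ℝ (fun y => f y + t • h y) x = fderiv ℝ f x + t • fderiv ℝ h x :=
    (hf.hasFDerivAt.add (hh.hasFDerivAt.const_smul t)).fderiv
  rw [fderiv_euclidean_apply hf, fderiv_euclidean_apply hh,
    fderiv_euclidean_apply (f := fun y => f y + t • h y) hd, hfd]
  simp

theorem continuous_jacobianMatrix {f : EuclideanSpace ℝ (Fin d) → EuclideanSpace ℝ (Fin d)}
    (hf : ContDiff ℝ ∞ f) : Continuous (jacobianMatrix fun i y => f y i) := by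
  refine continuous_matrix fun i k => ?_
  exact (contDiff_fderiv_apply_const ((contDiff_euclidean.1 hf) i) _).continuous

theorem jacobianMatrix_update (u : Fin d → EuclideanSpace ℝ (Fin d) → ℝ) (j : Fin d)
    (g : EuclideanSpace ℝ (Fin d) → ℝ) (x : EuclideanSpace ℝ (Fin d)) :
    jacobianMatrix (Function.update u j g) x =
      (jacobianMatrix u x).updateRow j fun k => fderiv ℝ g x (EuclideanSpace.single k 1) := by
  ext i k
  rcases eq_or_ne i j with rfl | hij
  · simp [jacobianMatrix]
  · simp [jacobianMatrix, hij]

/-- The variation of `χ * φ (f) * det (Df)` in direction `h` is a sum of Jacobian determinants,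
at points where `φ (f)` or the derivative of `χ` vanishes. -/
theorem sum_det_jacobianMatrix_update {f h : EuclideanSpace ℝ (Fin d) → EuclideanSpace ℝ (Fin d)}
    {φ χ : EuclideanSpace ℝ (Fin d) → ℝ} {x : EuclideanSpace ℝ (Fin d)}
    (hf : DifferentiableAt ℝ f x) (hh : DifferentiableAt ℝ h x) (hφ : DifferentiableAt ℝ φ (f x))
    (hχ : DifferentiableAt ℝ χ x) (hz : φ (f x) = 0 ∨ fderiv ℝ χ x = 0) :
    ∑ j, (jacobianMatrix (Function.update (fun i y => f y i) j
        fun y => χ y * φ (f y) * h y j) x).det =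
      χ x * fderiv ℝ φ (f x) (h x) * (jacobianMatrix (fun i y => f y i) x).det +
      χ x * φ (f x) * ∑ j, ((jacobianMatrix (fun i y => f y i) x).updateRow j
        (jacobianMatrix (fun i y => h y i) x j)).det := by
  set M := jacobianMatrix (fun i y => f y i) x with hM
  set B := jacobianMatrix (fun i y => h y i) x with hB
  have hrow : ∀ j, (fun k => fderiv ℝ (fun y => χ y * φ (f y) * h y j) x
      (EuclideanSpace.single k 1)) =
      (χ x * φ (f x)) • B j +
        ∑ i, (χ x * h x j * fderiv ℝ φ (f x) (EuclideanSpace.single i 1)) • M i := by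
    intro j
    ext k
    have hφf : HasFDerivAt (fun y => φ (f y)) ((fderiv ℝ φ (f x)).comp (fderiv ℝ f x)) x :=
      hφ.hasFDerivAt.comp x hf.hasFDerivAt
    have hhj : DifferentiableAt ℝ (fun y => h y j) x := (differentiableAt_euclidean.1 hh) j
    have hprod : fderiv ℝ (fun y => χ y * φ (f y) * h y j) x = _ :=
      ((hχ.hasFDerivAt.mul hφf).mul hhj.hasFDerivAt).fderiv
    rw [hprod]
    have hsum : fderiv ℝ φ (f x) (fderiv ℝ f x (EuclideanSpace.single k 1)) =
        ∑ i, fderiv ℝ φ (f x) (EuclideanSpace.single i 1) * M i k := by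
      rw [EuclideanSpace.continuousLinearMap_apply_eq_sum]
      refine Finset.sum_congr rfl fun i _ => ?_
      rw [hM, jacobianMatrix, Matrix.of_apply, fderiv_euclidean_apply hf]
    have hBk : B j k = fderiv ℝ (fun y => h y j) x (EuclideanSpace.single k 1) := rfl
    -- The only term of the product rule with a derivative of the cutoff; `hz` exists to discard it.
    have hzero : φ (f x) * fderiv ℝ χ x (EuclideanSpace.single k 1) = 0 := by
      rcases hz with hz | hz <;> simp [hz]
    have hrhs : ((χ x * φ (f x)) • B j +
        ∑ i, (χ x * h x j * fderiv ℝ φ (f x) (EuclideanSpace.single i 1)) • M i :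
          Fin d → ℝ) k = χ x * φ (f x) * B j k +
        χ x * h x j * ∑ i, fderiv ℝ φ (f x) (EuclideanSpace.single i 1) * M i k := by
      rw [Finset.mul_sum, Pi.add_apply, Finset.sum_apply, Pi.smul_apply, smul_eq_mul]
      simp only [Pi.smul_apply, smul_eq_mul, mul_assoc]
    rw [hrhs, ← hsum, hBk]
    simp only [add_apply, smul_apply, smul_eq_mul,
      ContinuousLinearMap.comp_apply, Pi.mul_apply]
    linear_combination h x j * hzero
  -- Of a combination of the rows `M i` placed in row `j`, only the coefficient of `M j` survives in
  -- the determinant.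
  have hdet : ∀ j, (jacobianMatrix (Function.update (fun i y => f y i) j
        fun y => χ y * φ (f y) * h y j) x).det =
      χ x * φ (f x) * (M.updateRow j (B j)).det +
        χ x * h x j * fderiv ℝ φ (f x) (EuclideanSpace.single j 1) * M.det := by
    intro j
    rw [jacobianMatrix_update, hrow, Matrix.det_updateRow_add, Matrix.det_updateRow_smul,
      Matrix.det_updateRow_sum, smul_eq_mul]
  rw [Finset.sum_congr rfl fun j _ => hdet j, Finset.sum_add_distrib, ← Finset.mul_sum,
    EuclideanSpace.continuousLinearMap_apply_eq_sum (fderiv ℝ φ (f x)) (h x),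
    Finset.mul_sum Finset.univ (fun i => fderiv ℝ φ (f x) (EuclideanSpace.single i 1) * h x i),
    Finset.sum_mul, add_comm]
  congr 1
  refine Finset.sum_congr rfl fun j _ => ?_
  ring

/-- The derivative in `t` of the integrand along `f + t • h` is a sum of Jacobian determinants, each
with one compactly supported component, so its integral vanishes. -/
theorem integral_mul_det_homotopy {f h : EuclideanSpace ℝ (Fin d) → EuclideanSpace ℝ (Fin d)}
    {φ χ : EuclideanSpace ℝ (Fin d) → ℝ} (hf : ContDiff ℝ ∞ f) (hh : ContDiff ℝ ∞ h)
    (hφ : ContDiff ℝ ∞ φ) (hχ : ContDiff ℝ ∞ χ) (hχc : HasCompactSupport χ)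
    (hz : ∀ t ∈ Icc (0 : ℝ) 1, ∀ x, φ (f x + t • h x) = 0 ∨ fderiv ℝ χ x = 0) :
    ∫ x, χ x * φ (f x) * (fderiv ℝ f x).det =
      ∫ x, χ x * φ (f x + h x) * (fderiv ℝ (fun y => f y + h y) x).det := by
  have hfd := hf.differentiable (by simp)
  have hhd := hh.differentiable (by simp)
  have hφd := hφ.differentiable (by simp)
  have hχd := hχ.differentiable (by simp)
  set A := jacobianMatrix fun i y => f y i with hA
  set B := jacobianMatrix fun i y => h y i with hB
  have hAc : Continuous A := continuous_jacobianMatrix hf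
  have hBc : Continuous B := continuous_jacobianMatrix hh
  set F : ℝ → EuclideanSpace ℝ (Fin d) → EuclideanSpace ℝ (Fin d) := fun t x => f x + t • h x
    with hF
  have hFs : ∀ t, ContDiff ℝ ∞ (F t) := fun t => hf.add (hh.const_smul t)
  have hFM : ∀ t x, jacobianMatrix (fun i y => F t y i) x = A x + t • B x := fun t x =>
    jacobianMatrix_add_smul (hfd x) (hhd x) t
  set G : ℝ → EuclideanSpace ℝ (Fin d) → ℝ := fun t x =>
    χ x * φ (F t x) * (A x + t • B x).det with hG
  set G' : ℝ → EuclideanSpace ℝ (Fin d) → ℝ := fun t x =>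
    χ x * fderiv ℝ φ (F t x) (h x) * (A x + t • B x).det +
      χ x * φ (F t x) * ∑ j, ((A x + t • B x).updateRow j (B x j)).det with hG'
  have hderiv : ∀ t x, HasDerivAt (fun s => G s x) (G' t x) t := by
    intro t x
    have h1 : HasDerivAt (fun s => F s x) (h x) t := by
      simpa [hF] using! ((hasDerivAt_id t).smul_const (h x)).const_add (f x)
    have h2 : HasDerivAt (fun s => φ (F s x)) (fderiv ℝ φ (F t x) (h x)) t :=
      (hφd (F t x)).hasFDerivAt.comp_hasDerivAt t h1
    exact (h2.const_mul (χ x)).mul (Matrix.hasDerivAt_det_add_smul (A x) (B x) t)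
  have hFc : Continuous fun p : ℝ × EuclideanSpace ℝ (Fin d) => F p.1 p.2 := by
    have := hf.continuous
    have := hh.continuous
    fun_prop
  have hMc : Continuous fun p : ℝ × EuclideanSpace ℝ (Fin d) => A p.2 + p.1 • B p.2 :=
    (hAc.comp continuous_snd).add (continuous_fst.smul (hBc.comp continuous_snd))
  have hχc' : Continuous fun p : ℝ × EuclideanSpace ℝ (Fin d) => χ p.2 :=
    hχ.continuous.comp continuous_snd
  have hGc : Continuous fun p : ℝ × EuclideanSpace ℝ (Fin d) => G p.1 p.2 :=
    (hχc'.mul (hφ.continuous.comp hFc)).mul hMc.matrix_det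
  have hG'c : Continuous fun p : ℝ × EuclideanSpace ℝ (Fin d) => G' p.1 p.2 := by
    refine ((hχc'.mul ?_).mul hMc.matrix_det).add
      ((hχc'.mul (hφ.continuous.comp hFc)).mul (continuous_finsetSum _ fun j _ => ?_))
    · exact ((hφ.continuous_fderiv (by simp)).comp hFc).clm_apply
        (hh.continuous.comp continuous_snd)
    · exact (hMc.matrix_updateRow j
        ((continuous_apply j).comp (hBc.comp continuous_snd))).matrix_det
  have hGt : ∀ t, Continuous (G t) := fun t => hGc.comp (Continuous.prodMk_right t)
  have hG't : ∀ t, Continuous (G' t) := fun t => hG'c.comp (Continuous.prodMk_right t)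
  have hGint : ∀ t, Integrable (G t) := fun t =>
    (hGt t).integrable_of_hasCompactSupport (hχc.mono fun x hx => by
      contrapose! hx
      simp only [Function.mem_support, not_not] at hx
      simp [hG, hx])
  have hint : ∀ t, HasDerivAt (fun s => ∫ x, G s x) (∫ x, G' t x) t := by
    intro t
    -- Domination: for times near `t` the derivative is bounded on the compact support of `χ` and
    -- zero elsewhere.
    obtain ⟨C, hC⟩ := ((isCompact_closedBall t 1).prod hχc).exists_bound_of_continuousOn
      hG'c.continuousOn
    refine (hasDerivAt_integral_of_dominated_loc_of_deriv_le
      (bound := (tsupport χ).indicator fun _ => C) (closedBall_mem_nhds t one_pos)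
      (Eventually.of_forall fun s => (hGt s).aestronglyMeasurable) (hGint t)
      (hG't t).aestronglyMeasurable (Eventually.of_forall fun x s hs => ?_) ?_
      (Eventually.of_forall fun x s _ => hderiv s x)).2
    · by_cases hx : x ∈ tsupport χ
      · simpa [hx] using hC (s, x) ⟨hs, hx⟩
      · have : χ x = 0 := image_eq_zero_of_notMem_tsupport hx
        simp [hx, hG', this]
    · exact (integrable_indicator_iff (isClosed_tsupport χ).measurableSet).2
        (integrableOn_const hχc.measure_lt_top.ne)
  have hzero : ∀ t ∈ Icc (0 : ℝ) 1, ∫ x, G' t x = 0 := by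
    intro t ht
    have hsmooth : ∀ j, ContDiff ℝ ∞ fun y => χ y * φ (F t y) * h y j := fun j =>
      (hχ.mul (hφ.comp (hFs t))).mul (contDiff_euclidean.1 hh j)
    have hcs : ∀ j, HasCompactSupport fun y => χ y * φ (F t y) * h y j := fun j =>
      (hχc.mul_right).mul_right
    have hupd : ∀ j i, ContDiff ℝ ∞ (Function.update (fun i y => F t y i) j
        (fun y => χ y * φ (F t y) * h y j) i) := by
      intro j i
      rcases eq_or_ne i j with rfl | hij
      · simpa using hsmooth i
      · simpa [hij] using contDiff_euclidean.1 (hFs t) i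
    have hcd : ∀ j, Integrable fun x => (jacobianMatrix (Function.update (fun i y => F t y i) j
        fun y => χ y * φ (F t y) * h y j) x).det := by
      intro j
      refine Continuous.integrable_of_hasCompactSupport ?_ ((hcs j).mono' ?_)
      · exact Continuous.matrix_det (continuous_matrix fun i k =>
          (contDiff_fderiv_apply_const (hupd j i) _).continuous)
      · intro x hx
        by_contra hx'
        refine hx (Matrix.det_eq_zero_of_row_eq_zero j fun k => ?_)
        rw [jacobianMatrix_update, Matrix.updateRow_self]
        have : fderiv ℝ (fun y => χ y * φ (F t y) * h y j) x = 0 := by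
          by_contra hne
          exact hx' (support_fderiv_subset ℝ hne)
        simp [this]
    have hpt : ∀ x, G' t x = ∑ j, (jacobianMatrix (Function.update (fun i y => F t y i) j
        fun y => χ y * φ (F t y) * h y j) x).det := by
      intro x
      rw [sum_det_jacobianMatrix_update (f := F t) ((hFs t).differentiable (by simp) x) (hhd x)
        (hφd _) (hχd x) (hz t ht x), hFM]
    simp_rw [hpt]
    rw [integral_finsetSum _ fun j _ => hcd j]
    refine Finset.sum_eq_zero fun j _ => integral_det_jacobianMatrix_eq_zero (hupd j) j ?_
    simpa using hcs j
  have hconst := constant_of_has_deriv_right_zero (f := fun s => ∫ x, G s x) (a := 0) (b := 1)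
    (fun t _ => (hint t).continuousAt.continuousWithinAt) (fun t ht => by
      simpa [hzero t ⟨ht.1, ht.2.le⟩] using (hint t).hasDerivWithinAt (s := Ici t)) 1 (by simp)
  have e0 : ∀ x, χ x * φ (f x) * (fderiv ℝ f x).det = G 0 x := by
    intro x
    rw [det_fderiv_eq_det_jacobianMatrix (hfd x)]
    simp [hG, hF, hA]
  have e1 : ∀ x, χ x * φ (f x + h x) * (fderiv ℝ (fun y => f y + h y) x).det = G 1 x := by
    intro x
    rw [det_fderiv_eq_det_jacobianMatrix (f := fun y => f y + h y) ((hfd.add hhd) x)]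
    have := hFM 1 x
    simp only [hF, one_smul] at this
    simp only [hG, hF, this, one_smul]
  simp_rw [e0, e1]
  exact hconst.symm

end Homotopy

/-! ### Signed counts of preimages -/

section SignSum

variable {d : ℕ} {f : EuclideanSpace ℝ (Fin d) → EuclideanSpace ℝ (Fin d)}
  {A : Set (EuclideanSpace ℝ (Fin d))} {z : EuclideanSpace ℝ (Fin d)}

theorem continuous_det_fderiv (hf : ContDiff ℝ ∞ f) : Continuous fun x => (fderiv ℝ f x).det :=
  ContinuousLinearMap.continuous_det.comp (hf.continuous_fderiv (by simp))

theorem exists_open_injOn_of_det_ne_zero (hf : ContDiff ℝ ∞ f) {x : EuclideanSpace ℝ (Fin d)}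
    (hx : (fderiv ℝ f x).det ≠ 0) {W : Set (EuclideanSpace ℝ (Fin d))} (hW : IsOpen W)
    (hxW : x ∈ W) :
    ∃ V, IsOpen V ∧ x ∈ V ∧ V ⊆ W ∧ InjOn f V ∧ f '' V ∈ 𝓝 (f x) ∧
      ∀ y ∈ V, SignType.sign (fderiv ℝ f y).det = SignType.sign (fderiv ℝ f x).det := by
  have hstrict : HasStrictFDerivAt f
      ((fderiv ℝ f x).toContinuousLinearEquivOfDetNeZero hx : _ →L[ℝ] _) x := by
    rw [ContinuousLinearMap.coe_toContinuousLinearEquivOfDetNeZero]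
    exact hf.contDiffAt.hasStrictFDerivAt (by simp)
  set e := hstrict.toOpenPartialHomeomorph f with he
  have hxe : x ∈ e.source := hstrict.mem_toOpenPartialHomeomorph_source
  have hco : (e : _ → _) = f := hstrict.toOpenPartialHomeomorph_coe
  set P : Set (EuclideanSpace ℝ (Fin d)) :=
    {y | 0 < (fderiv ℝ f y).det * (fderiv ℝ f x).det} with hP
  have hPo : IsOpen P := isOpen_lt continuous_const ((continuous_det_fderiv hf).mul continuous_const)
  have hVo : IsOpen (W ∩ e.source ∩ P) := (hW.inter e.open_source).inter hPo
  have hxV : x ∈ W ∩ e.source ∩ P := ⟨⟨hxW, hxe⟩, mul_self_pos.2 hx⟩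
  refine ⟨W ∩ e.source ∩ P, hVo, hxV, fun y hy => hy.1.1, ?_, ?_, ?_⟩
  · exact (hco ▸ e.injOn).mono fun y hy => hy.1.2
  · have := e.isOpen_image_of_subset_source hVo fun y hy => hy.1.2
    rw [hco] at this
    exact this.mem_nhds (mem_image_of_mem f hxV)
  · intro y hy
    rcases pos_and_pos_or_neg_and_neg_of_mul_pos (mem_ofPred.1 hy.2) with h | h
    · rw [sign_pos h.1, sign_pos h.2]
    · rw [sign_neg h.1, sign_neg h.2]

/-- The solutions form a compact set, as none lies on the boundary, and are isolated by the inverse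
function theorem. -/
theorem finite_preimage_of_regular (hb : Bornology.IsBounded A)
    (hf : ContDiff ℝ ∞ f) (hz : z ∉ f '' frontier A)
    (hreg : ∀ x ∈ A, f x = z → (fderiv ℝ f x).det ≠ 0) : {x | x ∈ A ∧ f x = z}.Finite := by
  have hS : {x | x ∈ A ∧ f x = z} = closure A ∩ f ⁻¹' {z} := by
    ext x
    refine ⟨fun h => ⟨subset_closure h.1, h.2⟩, fun h => ⟨?_, h.2⟩⟩
    by_contra hx
    exact hz ⟨x, ⟨h.1, fun h' => hx (interior_subset h')⟩, h.2⟩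
  have hc : IsCompact {x | x ∈ A ∧ f x = z} := by
    rw [hS]
    exact hb.isCompact_closure.inter_right (isClosed_singleton.preimage hf.continuous)
  have hV : ∀ x ∈ {x | x ∈ A ∧ f x = z}, ∃ V, IsOpen V ∧ x ∈ V ∧ InjOn f V := fun x hx => by
    obtain ⟨V, h1, h2, -, h3, -⟩ := exists_open_injOn_of_det_ne_zero hf (hreg x hx.1 hx.2)
      isOpen_univ (mem_univ x)
    exact ⟨V, h1, h2, h3⟩
  choose! V hVo hxV hinj using hV
  obtain ⟨t, ht, hcov⟩ := hc.elim_nhds_subcover V fun x hx => (hVo x hx).mem_nhds (hxV x hx)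
  refine t.finite_toSet.subset fun x hx => ?_
  obtain ⟨y, hy, hxy⟩ := mem_iUnion₂.1 (hcov hx)
  rwa [hinj y (ht y hy) hxy (hxV y (ht y hy)) (hx.2.trans (ht y hy).2.symm)]

/-- Near `z` the preimage splits into finitely many disjoint sheets on which `f` is injective; the
change of variables turns each into one sign. -/
theorem exists_forall_integral_eq_signSum (hb : Bornology.IsBounded A) (ho : IsOpen A)
    (hf : ContDiff ℝ ∞ f) (hz : z ∉ f '' frontier A)
    (hreg : ∀ x ∈ A, f x = z → (fderiv ℝ f x).det ≠ 0) :
    ∃ r > 0, ∀ φ : EuclideanSpace ℝ (Fin d) → ℝ, Continuous φ →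
      Function.support φ ⊆ ball z r → ∫ x, φ x = 1 →
      ∫ x in A, φ (f x) * (fderiv ℝ f x).det = signSum f A z := by
  have hfin := finite_preimage_of_regular hb hf hz hreg
  obtain ⟨U, hU, hdisj⟩ := hfin.t2_separation
  have hV : ∀ x ∈ {x | x ∈ A ∧ f x = z}, ∃ V, IsOpen V ∧ x ∈ V ∧ V ⊆ A ∩ U x ∧ InjOn f V ∧
      f '' V ∈ 𝓝 (f x) ∧
      ∀ y ∈ V, SignType.sign (fderiv ℝ f y).det = SignType.sign (fderiv ℝ f x).det :=
    fun x hx => exists_open_injOn_of_det_ne_zero hf (hreg x hx.1 hx.2)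
      (ho.inter (hU x).2) ⟨hx.1, (hU x).1⟩
  choose! V hVo hxV hVsub hinj hnhds hsign using hV
  set T := hfin.toFinset with hT
  have hmem : ∀ {x}, x ∈ T ↔ x ∈ A ∧ f x = z := by simp [hT]
  have hC : IsCompact (f '' (closure A \ ⋃ x ∈ T, V x)) :=
    (hb.isCompact_closure.diff (isOpen_biUnion fun x hx => hVo x (hmem.1 hx))).image hf.continuous
  have hzC : z ∉ f '' (closure A \ ⋃ x ∈ T, V x) := by
    rintro ⟨x, ⟨hxA, hxV'⟩, hxz⟩
    by_cases hx : x ∈ A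
    · exact hxV' (mem_iUnion₂.2 ⟨x, hmem.2 ⟨hx, hxz⟩, hxV x ⟨hx, hxz⟩⟩)
    · exact hz ⟨x, ⟨hxA, fun h' => hx (interior_subset h')⟩, hxz⟩
  -- Values near `z` are attained on every sheet and nowhere else in `closure A`.
  have hN : (⋂ x ∈ T, f '' V x) ∩ (f '' (closure A \ ⋃ x ∈ T, V x))ᶜ ∈ 𝓝 z := by
    refine inter_mem ((biInter_finset_mem T).2 fun x hx => ?_)
      (hC.isClosed.isOpen_compl.mem_nhds hzC)
    simpa [(hmem.1 hx).2] using hnhds x (hmem.1 hx)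
  obtain ⟨r, hr, hball⟩ := Metric.mem_nhds_iff.1 hN
  refine ⟨r, hr, fun φ hφ hsupp hint => ?_⟩
  have hcont : Continuous fun x => φ (f x) * (fderiv ℝ f x).det :=
    (hφ.comp hf.continuous).mul (continuous_det_fderiv hf)
  have hsubA : ⋃ x ∈ T, V x ⊆ A :=
    iUnion₂_subset fun x hx => (hVsub x (hmem.1 hx)).trans inter_subset_left
  have hφ0 : ∀ w, w ∉ ball z r → φ w = 0 := fun w hw => by
    by_contra h
    exact hw (hsupp h)
  have hloc : ∀ x ∈ T, ∫ y in V x, φ (f y) * (fderiv ℝ f y).det =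
      ((SignType.sign (fderiv ℝ f x).det : ℤ) : ℝ) := by
    intro x hx
    have hx' := hmem.1 hx
    have h1 : ∫ y in V x, φ (f y) * (fderiv ℝ f y).det =
        ∫ y in V x, ((SignType.sign (fderiv ℝ f x).det : ℤ) : ℝ) *
          (|(fderiv ℝ f y).det| • φ (f y)) := by
      refine setIntegral_congr_fun (hVo x hx').measurableSet fun y hy => ?_
      rw [← hsign x hx' y hy]
      simp only [smul_eq_mul]
      rw [← mul_assoc, mul_comm (φ (f y))]
      congr 1
      rcases lt_trichotomy (fderiv ℝ f y).det 0 with h | h | h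
      · simp [h, abs_of_neg h]
      · simp [h]
      · simp [h, abs_of_pos h]
    rw [h1, integral_const_mul, ← integral_image_eq_integral_abs_det_fderiv_smul volume
      (hVo x hx').measurableSet (fun y _ =>
        ((hf.differentiable (by simp)) y).hasFDerivAt.hasFDerivWithinAt) (hinj x hx') φ,
      setIntegral_eq_integral_of_forall_compl_eq_zero, hint, mul_one]
    intro w hw
    refine hφ0 w fun h => hw ?_
    exact mem_iInter₂.1 (hball h).1 x hx
  rw [setIntegral_eq_of_subset_of_forall_sdiff_eq_zero ho.measurableSet hsubA,
    integral_biUnion_finset T (fun x hx => (hVo x (hmem.1 hx)).measurableSet),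
    Finset.sum_congr rfl hloc, signSum, finsum_mem_eq_finite_toFinset_sum _ hfin]
  · push_cast
    rfl
  · intro x hx y hy hxy
    exact (hdisj (hmem.1 hx) (hmem.1 hy) hxy).mono
      ((hVsub x (hmem.1 hx)).trans inter_subset_right)
      ((hVsub y (hmem.1 hy)).trans inter_subset_right)
  · intro x hx
    exact (hcont.continuousOn.integrableOn_compact hb.isCompact_closure).mono_set
      (((hVsub x (hmem.1 hx)).trans inter_subset_left).trans subset_closure)
  · intro x hx
    rw [hφ0 (f x) fun h => (hball h).2 ⟨x, ⟨subset_closure hx.1, hx.2⟩, rfl⟩, zero_mul]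

/-- Equality with 1 near each point of `K`, not only at it, makes the derivative of `χ` vanish on
`K`. Of the two intermediate compact sets, `χ` is 1 on the first and supported in the second. -/
theorem exists_cutoff {K : Set (EuclideanSpace ℝ (Fin d))} (hK : IsCompact K) (ho : IsOpen A)
    (hKA : K ⊆ A) : ∃ χ : EuclideanSpace ℝ (Fin d) → ℝ, ContDiff ℝ ∞ χ ∧ HasCompactSupport χ ∧
      Function.support χ ⊆ A ∧ ∀ x ∈ K, χ =ᶠ[𝓝 x] 1 := by
  obtain ⟨L, hL, hKL, hLA⟩ := exists_compact_between hK ho hKA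
  obtain ⟨L', hL', hLL', hLA'⟩ := exists_compact_between hL ho hLA
  obtain ⟨χ, h1, -, h2, h3⟩ := exists_contMDiff_support_eq_eq_one_iff (n := ⊤)
    (modelWithCornersSelf ℝ (EuclideanSpace ℝ (Fin d))) isOpen_interior hL.isClosed hLL'
  refine ⟨χ, h1.contDiff, HasCompactSupport.of_support_subset_isCompact hL' ?_, ?_, fun x hx => ?_⟩
  · rw [h2]
    exact interior_subset
  · rw [h2]
    exact interior_subset.trans hLA'
  · filter_upwards [isOpen_interior.mem_nhds (hKL hx)] with w hw
    exact (h3 w).1 (interior_subset hw)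

/-- Homotopy invariance of the signed count of preimages. -/
theorem signSum_eq_of_homotopy {f₀ f₁ : EuclideanSpace ℝ (Fin d) → EuclideanSpace ℝ (Fin d)}
    (hb : Bornology.IsBounded A) (ho : IsOpen A) (hf₀ : ContDiff ℝ ∞ f₀) (hf₁ : ContDiff ℝ ∞ f₁)
    (hreg₀ : ∀ x ∈ A, f₀ x = z → (fderiv ℝ f₀ x).det ≠ 0)
    (hreg₁ : ∀ x ∈ A, f₁ x = z → (fderiv ℝ f₁ x).det ≠ 0)
    (hbd : ∀ t ∈ Icc (0 : ℝ) 1, ∀ x ∈ frontier A, f₀ x + t • (f₁ x - f₀ x) ≠ z) :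
    signSum f₀ A z = signSum f₁ A z := by
  have hz₀ : z ∉ f₀ '' frontier A := by
    rintro ⟨x, hx, h⟩
    exact hbd 0 (by simp) x hx (by simpa using h)
  have hz₁ : z ∉ f₁ '' frontier A := by
    rintro ⟨x, hx, h⟩
    exact hbd 1 (by simp) x hx (by simpa using h)
  set F : ℝ × EuclideanSpace ℝ (Fin d) → EuclideanSpace ℝ (Fin d) := fun p =>
    f₀ p.2 + p.1 • (f₁ p.2 - f₀ p.2) with hF
  have hFc : Continuous F := by
    have := hf₀.continuous
    have := hf₁.continuous
    fun_prop
  have hfr : IsCompact (frontier A) :=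
    hb.isCompact_closure.of_isClosed_subset isClosed_frontier frontier_subset_closure
  have hN : (F '' (Icc (0 : ℝ) 1 ×ˢ frontier A))ᶜ ∈ 𝓝 z := by
    refine ((isCompact_Icc.prod hfr).image hFc).isClosed.isOpen_compl.mem_nhds ?_
    rintro ⟨p, hp, h⟩
    exact hbd p.1 hp.1 p.2 hp.2 h
  obtain ⟨ρ, hρ, hball⟩ := Metric.nhds_basis_closedBall.mem_iff.1 hN
  -- The points carried within `ρ` of `z` at some time of the homotopy. By the choice of `ρ` none is
  -- on the boundary, so a cutoff equal to 1 near `K` leaves both integrals over `A` unchanged, and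
  -- its derivative vanishes wherever the bump along the homotopy does not.
  set K := Prod.snd '' ((Icc (0 : ℝ) 1 ×ˢ closure A) ∩ F ⁻¹' closedBall z ρ) with hK
  have hKc : IsCompact K := ((isCompact_Icc.prod hb.isCompact_closure).inter_right
    (isClosed_closedBall.preimage hFc)).image continuous_snd
  have hKA : K ⊆ A := by
    rintro _ ⟨p, ⟨hp, hpF⟩, rfl⟩
    by_contra hx
    exact hball hpF ⟨p, ⟨hp.1, hp.2, fun h' => hx (interior_subset h')⟩, rfl⟩
  obtain ⟨χ, hχ, hχc, hχA, hχ1⟩ := exists_cutoff hKc ho hKA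
  obtain ⟨r₀, hr₀, H₀⟩ := exists_forall_integral_eq_signSum hb ho hf₀ hz₀ hreg₀
  obtain ⟨r₁, hr₁, H₁⟩ := exists_forall_integral_eq_signSum hb ho hf₁ hz₁ hreg₁
  have hr : 0 < min ρ (min r₀ r₁) := lt_min hρ (lt_min hr₀ hr₁)
  let b : ContDiffBump z := ⟨min ρ (min r₀ r₁) / 2, min ρ (min r₀ r₁), half_pos hr, half_lt_self hr⟩
  set φ : EuclideanSpace ℝ (Fin d) → ℝ := b.normed volume with hφ
  have hφs : ContDiff ℝ ∞ φ := b.contDiff_normed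
  have hsupp : Function.support φ = ball z (min ρ (min r₀ r₁)) := b.support_normed_eq
  have hint : ∫ x, φ x = 1 := b.integral_normed
  have hmemK : ∀ t ∈ Icc (0 : ℝ) 1, ∀ x ∈ closure A, φ (F (t, x)) ≠ 0 → x ∈ K := by
    intro t ht x hx hne
    have : F (t, x) ∈ ball z (min ρ (min r₀ r₁)) := hsupp ▸ hne
    exact ⟨(t, x), ⟨⟨ht, hx⟩, ball_subset_closedBall (ball_subset_ball (min_le_left _ _) this)⟩, rfl⟩
  have hhom := integral_mul_det_homotopy hf₀ (hf₁.sub hf₀) hφs hχ hχc (by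
    intro t ht x
    by_contra! hcon
    by_cases hx : x ∈ closure A
    · exact hcon.2 ((hχ1 x (hmemK t ht x hx hcon.1)).fderiv_eq.trans (by simp))
    · refine hcon.2 ?_
      have : χ =ᶠ[𝓝 x] fun _ => 0 := by
        filter_upwards [isClosed_closure.isOpen_compl.mem_nhds hx] with w hw
        by_contra h
        exact hw (subset_closure (hχA h))
      rw [this.fderiv_eq]
      simp)
  have hcut : ∀ g : EuclideanSpace ℝ (Fin d) → EuclideanSpace ℝ (Fin d),
      (∀ x ∈ A, φ (g x) ≠ 0 → x ∈ K) → ∫ x, χ x * φ (g x) * (fderiv ℝ g x).det =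
        ∫ x in A, φ (g x) * (fderiv ℝ g x).det := by
    intro g hg
    rw [← setIntegral_eq_integral_of_forall_compl_eq_zero (s := A)]
    · refine setIntegral_congr_fun ho.measurableSet fun x hx => ?_
      by_cases hne : φ (g x) = 0
      · simp [hne]
      · simp [(hχ1 x (hg x hx hne)).eq_of_nhds]
    · intro x hx
      have : χ x = 0 := by
        by_contra h
        exact hx (hχA h)
      simp [this]
  simp only [add_sub_cancel] at hhom
  rw [hcut f₀ fun x hx h => hmemK 0 (by simp) x (subset_closure hx) (by simpa [hF] using h),
    hcut f₁ fun x hx h => hmemK 1 (by simp) x (subset_closure hx) (by simpa [hF] using h),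
    H₀ φ hφs.continuous (hsupp.le.trans (ball_subset_ball
      ((min_le_right _ _).trans (min_le_left _ _)))) hint,
    H₁ φ hφs.continuous (hsupp.le.trans (ball_subset_ball
      ((min_le_right _ _).trans (min_le_right _ _)))) hint] at hhom
  exact_mod_cast hhom

end SignSum

/-! ### Properties of the Brouwer degree -/

section BrouwerDegree

variable {d : ℕ} {y f : EuclideanSpace ℝ (Fin d) → EuclideanSpace ℝ (Fin d)}
  {A : Set (EuclideanSpace ℝ (Fin d))} {z : EuclideanSpace ℝ (Fin d)}

/-- Smooth functions with `z` as a regular value are uniformly dense on compact sets. -/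
theorem exists_contDiff_dist_lt_regular {C : Set (EuclideanSpace ℝ (Fin d))} (hC : IsCompact C)
    (hy : ContinuousOn y C) (z : EuclideanSpace ℝ (Fin d)) {ε : ℝ} (hε : 0 < ε) :
    ∃ f : EuclideanSpace ℝ (Fin d) → EuclideanSpace ℝ (Fin d), ContDiff ℝ ∞ f ∧
      (∀ x ∈ C, dist (f x) (y x) < ε) ∧ ∀ x, f x = z → (fderiv ℝ f x).det ≠ 0 := by
  obtain ⟨Y, hY⟩ := ContinuousMap.exists_restrict_eq hC.isClosed
    (⟨C.domRestrict y, hy.domRestrict⟩ : C(C, EuclideanSpace ℝ (Fin d)))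
  have hYy : ∀ x ∈ C, Y x = y x := fun x hx => DFunLike.congr_fun hY ⟨x, hx⟩
  have hdense := ContinuousMap.dense_setOfPred_contDiff Y
  rw [mem_closure_iff_nhds_basis
    (nhds_basis_uniformity uniformity_basis_dist.compactConvergenceUniformity)] at hdense
  obtain ⟨g, hg, hgY⟩ := hdense (C, ε / 2) ⟨hC, half_pos hε⟩
  have hg' : ContDiff ℝ ∞ g := hg
  -- Sard's theorem in equal dimensions yields a regular value `w` of `g` within `ε / 2` of `z`;
  -- translation by `z - w` makes `z` regular.
  have hsard : volume (g '' {x | (fderiv ℝ g x).det = 0}) = 0 :=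
    addHaar_image_eq_zero_of_det_fderivWithin_eq_zero volume
      (fun x _ => ((hg'.differentiable (by simp)) x).hasFDerivAt.hasFDerivWithinAt) fun x hx => hx
  obtain ⟨w, hw, hwz⟩ := (Measure.dense_of_ae
    (measure_eq_zero_iff_ae_notMem.1 hsard)).exists_dist_lt z (half_pos hε)
  refine ⟨fun x => g x + (z - w), hg'.add contDiff_const, fun x hx => ?_, fun x hx hdet => ?_⟩
  · calc dist (g x + (z - w)) (y x) ≤ dist (g x + (z - w)) (g x) + dist (g x) (y x) :=
        dist_triangle _ _ _
      _ < ε / 2 + ε / 2 := by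
        refine add_lt_add ?_ ?_
        · rwa [dist_eq_norm, add_sub_cancel_left, ← dist_eq_norm]
        · have : dist (g x) (Y x) < ε / 2 := hgY x hx
          rwa [hYy x hx] at this
      _ = ε := add_halves ε
  · refine hw ⟨x, ?_, ?_⟩
    · rwa [fderiv_add_const] at hdet
    · have : g x + (z - w) = z := hx
      exact add_right_cancel (this.trans (add_sub_cancel w z).symm)

/-- On the boundary, two regular approximations both lie in the ball about `y x` that just excludes
`z`; by convexity the segment homotopy avoids `z`. -/
theorem brouwerDeg_eq_signSum (hb : Bornology.IsBounded A) (ho : IsOpen A)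
    (hf : IsRegularApprox y A z f) : brouwerDeg y A z = signSum f A z := by
  have hex : ∃ f, IsRegularApprox y A z f := ⟨f, hf⟩
  have hg := hex.choose_spec
  rw [brouwerDeg, dif_pos hex]
  refine signSum_eq_of_homotopy hb ho hg.1 hf.1 hg.2.2 hf.2.2 fun t ht x hx h => ?_
  have hcl := frontier_subset_closure hx
  have := (convex_ball (y x) (dist z (y x))).add_smul_sub_mem (hg.2.1 x hcl x hx)
    (hf.2.1 x hcl x hx) ht
  rw [h] at this
  exact lt_irrefl _ (mem_ball.1 this)

theorem exists_pos_forall_le_dist {K : Set (EuclideanSpace ℝ (Fin d))} (hK : IsCompact K)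
    (hy : ContinuousOn y K) (hz : z ∉ y '' K) : ∃ δ > 0, ∀ w ∈ K, δ ≤ dist z (y w) := by
  obtain ⟨δ, hδ, hball⟩ := Metric.mem_nhds_iff.1
    ((hK.image_of_continuousOn hy).isClosed.isOpen_compl.mem_nhds hz)
  refine ⟨δ, hδ, fun w hw => ?_⟩
  by_contra! h
  exact hball (mem_ball'.2 h) ⟨w, hw, rfl⟩

theorem isCompact_frontier_of_isBounded (hb : Bornology.IsBounded A) : IsCompact (frontier A) :=
  hb.isCompact_closure.of_isClosed_subset isClosed_frontier frontier_subset_closure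

/-- The degree is locally constant in the value. -/
theorem eventually_brouwerDeg_eq (hb : Bornology.IsBounded A) (ho : IsOpen A)
    (hy : ContinuousOn y (closure A)) (hz : z ∉ y '' frontier A) :
    ∀ᶠ w in 𝓝 z, w ∉ y '' frontier A ∧ brouwerDeg y A w = brouwerDeg y A z := by
  obtain ⟨δ, hδ, hdist⟩ := exists_pos_forall_le_dist (isCompact_frontier_of_isBounded hb)
    (hy.mono frontier_subset_closure) hz
  obtain ⟨f, hf, hfy, hreg⟩ := exists_contDiff_dist_lt_regular hb.isCompact_closure hy z
    (show 0 < δ / 4 by linarith)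
  filter_upwards [ball_mem_nhds z (show 0 < δ / 4 by linarith)] with w hw
  rw [mem_ball] at hw
  -- The translate `f + (w - z)` is within `δ / 4 + δ / 4` of `y`, below this `3 * δ / 4`. It is
  -- thus a regular approximation at `w`, with the solutions and derivatives that `f` has at `z`.
  have hdist' : ∀ v ∈ frontier A, 3 * δ / 4 ≤ dist w (y v) := by
    intro v hv
    have h1 := hdist v hv
    have h2 := dist_triangle z w (y v)
    rw [dist_comm z w] at h2
    linarith
  refine ⟨?_, ?_⟩
  · rintro ⟨v, hv, rfl⟩
    have := hdist' v hv
    rw [dist_self] at this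
    linarith
  · have hfz : IsRegularApprox y A z f :=
      ⟨hf, fun x hx v hv => (hfy x hx).trans_le (by linarith [hdist v hv]), fun x _ => hreg x⟩
    have hiff : ∀ x, f x + (w - z) = w ↔ f x = z := fun x =>
      ⟨fun h => add_right_cancel (h.trans (add_sub_cancel z w).symm), fun h => by rw [h]; abel⟩
    have hder : ∀ x, fderiv ℝ (fun x => f x + (w - z)) x = fderiv ℝ f x := fun x =>
      fderiv_add_const _
    have hfw : IsRegularApprox y A w fun x => f x + (w - z) := by
      refine ⟨hf.add contDiff_const, fun x hx v hv => ?_, fun x _ h => ?_⟩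
      · have h1 := hdist' v hv
        have h2 := dist_triangle (f x + (w - z)) (f x) (y x)
        have h3 : dist (f x + (w - z)) (f x) = dist w z := by
          rw [dist_eq_norm, add_sub_cancel_left, ← dist_eq_norm]
        linarith [hfy x hx]
      · rw [hder]
        exact hreg x ((hiff x).1 h)
    rw [brouwerDeg_eq_signSum hb ho hfz, brouwerDeg_eq_signSum hb ho hfw]
    simp only [signSum, hiff, hder]

/-- Additivity of the degree with respect to the domain. -/
theorem brouwerDeg_eq_add {A₁ A₂ : Set (EuclideanSpace ℝ (Fin d))} (hb : Bornology.IsBounded A)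
    (ho : IsOpen A) (ho₁ : IsOpen A₁) (ho₂ : IsOpen A₂) (h₁ : A₁ ⊆ A) (h₂ : A₂ ⊆ A)
    (hdisj : Disjoint A₁ A₂) (hy : ContinuousOn y (closure A))
    (hz : z ∉ y '' (closure A \ (A₁ ∪ A₂))) :
    brouwerDeg y A z = brouwerDeg y A₁ z + brouwerDeg y A₂ z := by
  obtain ⟨δ, hδ, hdist⟩ := exists_pos_forall_le_dist
    (hb.isCompact_closure.diff (ho₁.union ho₂)) (hy.mono sdiff_subset) hz
  obtain ⟨f, hf, hfy, hreg⟩ := exists_contDiff_dist_lt_regular hb.isCompact_closure hy z hδ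
  -- All three frontiers lie in the set whose image avoids `z`, so one approximation computes all
  -- three degrees.
  have happrox : ∀ B ⊆ A, frontier B ⊆ closure A \ (A₁ ∪ A₂) → IsRegularApprox y B z f :=
    fun B hB hfr => ⟨hf, fun x hx w hw => (hfy x (closure_mono hB hx)).trans_le (hdist w (hfr hw)),
      fun x _ => hreg x⟩
  have hfrA : frontier A ⊆ closure A \ (A₁ ∪ A₂) := fun x hx =>
    ⟨frontier_subset_closure hx, fun h => (ho.frontier_eq ▸ hx).2 (union_subset h₁ h₂ h)⟩
  have hfr₁ : frontier A₁ ⊆ closure A \ (A₁ ∪ A₂) := fun x hx =>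
    ⟨closure_mono h₁ (frontier_subset_closure hx), fun h => h.elim (ho₁.frontier_eq ▸ hx).2
      fun h' => (hdisj.closure_left ho₂).le_bot ⟨frontier_subset_closure hx, h'⟩⟩
  have hfr₂ : frontier A₂ ⊆ closure A \ (A₁ ∪ A₂) := fun x hx =>
    ⟨closure_mono h₂ (frontier_subset_closure hx), fun h => h.elim
      (fun h' => (hdisj.closure_right ho₁).le_bot ⟨h', frontier_subset_closure hx⟩)
      (ho₂.frontier_eq ▸ hx).2⟩
  have hb₁ := hb.subset h₁
  have hb₂ := hb.subset h₂
  rw [brouwerDeg_eq_signSum hb ho (happrox A subset_rfl hfrA),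
    brouwerDeg_eq_signSum hb₁ ho₁ (happrox A₁ h₁ hfr₁),
    brouwerDeg_eq_signSum hb₂ ho₂ (happrox A₂ h₂ hfr₂)]
  have hzf : ∀ x ∈ closure A \ (A₁ ∪ A₂), f x ≠ z := fun x hx h => by
    have h1 := hfy x hx.1
    rw [h] at h1
    exact absurd (hdist x hx) (not_le.2 h1)
  have hset : {x | x ∈ A ∧ f x = z} = {x | x ∈ A₁ ∧ f x = z} ∪ {x | x ∈ A₂ ∧ f x = z} := by
    ext x
    refine ⟨fun hx => ?_, fun hx => hx.elim (fun h => ⟨h₁ h.1, h.2⟩) fun h => ⟨h₂ h.1, h.2⟩⟩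
    by_contra hcon
    exact hzf x ⟨subset_closure hx.1, fun h => hcon (h.imp (⟨·, hx.2⟩) (⟨·, hx.2⟩))⟩ hx.2
  have hfin : ∀ B ⊆ A, frontier B ⊆ closure A \ (A₁ ∪ A₂) → {x | x ∈ B ∧ f x = z}.Finite :=
    fun B hB hfr => finite_preimage_of_regular (hb.subset hB) hf
      (by rintro ⟨x, hx, h⟩; exact hzf x (hfr hx) h) fun x _ => hreg x
  rw [signSum, hset, finsum_mem_union _ (hfin A₁ h₁ hfr₁) (hfin A₂ h₂ hfr₂)]
  · rfl
  · exact disjoint_left.2 fun x hx hx' => disjoint_left.1 hdisj hx.1 hx'.1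

theorem brouwerDeg_empty : brouwerDeg y ∅ z = 0 := by
  unfold brouwerDeg
  split_ifs <;> simp [signSum]

/-- The excision property of the degree. -/
theorem brouwerDeg_eq_of_subset {B : Set (EuclideanSpace ℝ (Fin d))} (hb : Bornology.IsBounded A)
    (ho : IsOpen A) (hoB : IsOpen B) (hBA : B ⊆ A) (hy : ContinuousOn y (closure A))
    (hz : z ∉ y '' (closure A \ B)) : brouwerDeg y A z = brouwerDeg y B z := by
  have := brouwerDeg_eq_add hb ho hoB isOpen_empty hBA (empty_subset A) (disjoint_empty B) hy
    (by simpa using hz)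
  simpa [brouwerDeg_empty] using this

theorem mem_image_of_brouwerDeg_ne_zero (hb : Bornology.IsBounded A) (ho : IsOpen A)
    (hy : ContinuousOn y (closure A)) (hz : z ∉ y '' frontier A) (hdeg : brouwerDeg y A z ≠ 0) :
    z ∈ y '' A := by
  by_contra hzA
  refine hdeg ((brouwerDeg_eq_of_subset hb ho isOpen_empty (empty_subset A) hy ?_).trans
    brouwerDeg_empty)
  rintro ⟨x, hx, rfl⟩
  by_cases hxA : x ∈ A
  · exact hzA ⟨x, hxA, rfl⟩
  · exact hz ⟨x, ⟨hx.1, fun h => hxA (interior_subset h)⟩, rfl⟩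

/-- Excision to a neighbourhood of the compact solution set. It transfers hypotheses on sets
compactly contained in `Ω` to sets that reach the boundary of `Ω`. -/
theorem exists_compactly_contained_brouwerDeg_eq (hb : Bornology.IsBounded A) (ho : IsOpen A)
    (hy : ContinuousOn y (closure A)) (hz : z ∉ y '' frontier A) :
    ∃ B, IsOpen B ∧ IsCompact (closure B) ∧ closure B ⊆ A ∧ z ∉ y '' frontier B ∧
      (∀ x ∈ A, y x = z → x ∈ B) ∧ brouwerDeg y A z = brouwerDeg y B z := by
  have hS : IsCompact (closure A ∩ y ⁻¹' {z}) := hb.isCompact_closure.of_isClosed_subset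
    (hy.preimage_isClosed_of_isClosed isClosed_closure isClosed_singleton) inter_subset_left
  have hSA : closure A ∩ y ⁻¹' {z} ⊆ A := fun x hx => by
    by_contra hxA
    exact hz ⟨x, ⟨hx.1, fun h => hxA (interior_subset h)⟩, hx.2⟩
  obtain ⟨L, hL, hSL, hLA⟩ := exists_compact_between hS ho hSA
  have hcl : closure (interior L) ⊆ L := closure_minimal interior_subset hL.isClosed
  have hsol : ∀ x ∈ closure A, y x = z → x ∈ interior L := fun x hx h => hSL ⟨hx, h⟩
  refine ⟨interior L, isOpen_interior, hL.of_isClosed_subset isClosed_closure hcl, hcl.trans hLA,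
    ?_, fun x hx => hsol x (subset_closure hx), brouwerDeg_eq_of_subset hb ho isOpen_interior
      (interior_subset.trans hLA) hy ?_⟩
  · rintro ⟨x, hx, h⟩
    rw [isOpen_interior.frontier_eq] at hx
    exact hx.2 (hsol x (subset_closure (hLA (hcl hx.1))) h)
  · rintro ⟨x, hx, h⟩
    exact hx.2 (hsol x hx.1 h)

end BrouwerDegree

/-! ### Counting arguments for nonnegative, non-degenerate degree -/

/-- `y` is continuous up to the boundary of the bounded open set `U`, and on the open subsets of
`U` its degree is nonnegative and non-degenerate. -/
structure PositiveDegreeOn {d : ℕ} (y : EuclideanSpace ℝ (Fin d) → EuclideanSpace ℝ (Fin d))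
    (U : Set (EuclideanSpace ℝ (Fin d))) : Prop where
  isOpen : IsOpen U
  isBounded : Bornology.IsBounded U
  continuousOn : ContinuousOn y (closure U)
  nonneg : ∀ A ⊆ U, IsOpen A → ∀ z ∉ y '' frontier A, 0 ≤ brouwerDeg y A z
  nondegenerate : ∀ V ⊆ U, IsOpen V → V.Nonempty → ∃ A ⊆ V, IsOpen A ∧
    ∃ z ∉ y '' frontier A, brouwerDeg y A z ≠ 0

namespace PositiveDegreeOn

variable {d : ℕ} {y : EuclideanSpace ℝ (Fin d) → EuclideanSpace ℝ (Fin d)}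
  {U A B : Set (EuclideanSpace ℝ (Fin d))} {z : EuclideanSpace ℝ (Fin d)}

theorem mono (h : PositiveDegreeOn y U) (hAU : A ⊆ U) (hA : IsOpen A) : PositiveDegreeOn y A where
  isOpen := hA
  isBounded := h.isBounded.subset hAU
  continuousOn := h.continuousOn.mono (closure_mono hAU)
  nonneg B hB := h.nonneg B (hB.trans hAU)
  nondegenerate V hV := h.nondegenerate V (hV.trans hAU)

theorem eventually_eq (h : PositiveDegreeOn y U) (hz : z ∉ y '' frontier U) :
    ∀ᶠ w in 𝓝 z, w ∉ y '' frontier U ∧ brouwerDeg y U w = brouwerDeg y U z :=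
  eventually_brouwerDeg_eq h.isBounded h.isOpen h.continuousOn hz

theorem mem_image (h : PositiveDegreeOn y U) (hz : z ∉ y '' frontier U)
    (hdeg : brouwerDeg y U z ≠ 0) : z ∈ y '' U :=
  mem_image_of_brouwerDeg_ne_zero h.isBounded h.isOpen h.continuousOn hz hdeg

/-- Every boundary point of `U \ closure A` lies on `frontier U` or `frontier A`. -/
theorem notMem_image_frontier_sdiff (hU : IsOpen U) (hA : IsOpen A) (hzA : z ∉ y '' frontier A)
    (hzU : z ∉ y '' frontier U) : z ∉ y '' frontier (U \ closure A) := by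
  rintro ⟨x, hx, rfl⟩
  have hxcl : x ∈ closure (U \ closure A) := frontier_subset_closure hx
  have hx2 := (hU.sdiff isClosed_closure).frontier_eq ▸ hx
  by_cases hxU : x ∈ U
  · have hxA : x ∈ closure A := by
      by_contra hcon
      exact hx2.2 ⟨hxU, hcon⟩
    refine hzA ⟨x, hA.frontier_eq ▸ ⟨hxA, fun hxA' => ?_⟩, rfl⟩
    obtain ⟨w, hw, hw'⟩ := _root_.mem_closure_iff.1 hxcl A hA hxA'
    exact hw'.2 (subset_closure hw)
  · exact hzU ⟨x, hU.frontier_eq ▸ ⟨closure_mono sdiff_subset hxcl, hxU⟩, rfl⟩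

theorem add_sdiff_eq (h : PositiveDegreeOn y U) (hAU : A ⊆ U) (hA : IsOpen A)
    (hzA : z ∉ y '' frontier A) (hzU : z ∉ y '' frontier U) :
    brouwerDeg y U z = brouwerDeg y A z + brouwerDeg y (U \ closure A) z := by
  refine brouwerDeg_eq_add h.isBounded h.isOpen hA (h.isOpen.sdiff isClosed_closure) hAU
    sdiff_subset (disjoint_left.2 fun x hx hx' => hx'.2 (subset_closure hx)) h.continuousOn ?_
  rintro ⟨x, ⟨hx, hx'⟩, rfl⟩
  by_cases hxU : x ∈ U
  · refine hzA ⟨x, hA.frontier_eq ▸ ⟨?_, fun hxA => hx' (Or.inl hxA)⟩, rfl⟩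
    by_contra hcon
    exact hx' (Or.inr ⟨hxU, hcon⟩)
  · exact hzU ⟨x, h.isOpen.frontier_eq ▸ ⟨hx, hxU⟩, rfl⟩

/-- The difference is the degree on `U \ closure A`, which is nonnegative. -/
theorem brouwerDeg_le (h : PositiveDegreeOn y U) (hAU : A ⊆ U) (hA : IsOpen A)
    (hzA : z ∉ y '' frontier A) (hzU : z ∉ y '' frontier U) :
    brouwerDeg y A z ≤ brouwerDeg y U z := by
  rw [h.add_sdiff_eq hAU hA hzA hzU]
  linarith [h.nonneg _ sdiff_subset (h.isOpen.sdiff (isClosed_closure (s := A))) z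
    (notMem_image_frontier_sdiff h.isOpen hA hzA hzU)]

/-- A point of positive degree with value in `N` exists in every open set meeting `y ⁻¹' N`. -/
theorem exists_one_le (h : PositiveDegreeOn y U) {N : Set (EuclideanSpace ℝ (Fin d))}
    (hN : IsOpen N) {x : EuclideanSpace ℝ (Fin d)} (hx : x ∈ U) (hxN : y x ∈ N) :
    ∃ A ⊆ U, IsOpen A ∧ ∃ w ∈ N, w ∉ y '' frontier A ∧ 1 ≤ brouwerDeg y A w := by
  obtain ⟨A, hA, hAo, w, hw, hdeg⟩ := h.nondegenerate (U ∩ y ⁻¹' N) inter_subset_left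
    ((h.continuousOn.mono subset_closure).isOpen_inter_preimage h.isOpen hN) ⟨x, hx, hxN⟩
  have hAU := hA.trans inter_subset_left
  obtain ⟨v, hv, rfl⟩ := (h.mono hAU hAo).mem_image hw hdeg
  exact ⟨A, hAU, hAo, y v, (hA hv).2, hw,
    Int.add_one_le_of_lt (lt_of_le_of_ne (h.nonneg A hAU hAo _ hw) hdeg.symm)⟩

/-- Near a preimage of `z`, non-degeneracy gives a value close to `z` with positive degree on a
subset; monotonicity passes it to `U`, local constancy back to `z`. -/
theorem one_le (h : PositiveDegreeOn y U) (hzU : z ∉ y '' frontier U) (hz : z ∈ y '' U) :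
    1 ≤ brouwerDeg y U z := by
  obtain ⟨N, hN, hNo, hzN⟩ := _root_.eventually_nhds_iff.1 (h.eventually_eq hzU)
  obtain ⟨x, hx, rfl⟩ := hz
  obtain ⟨A, hAU, hAo, w, hwN, hwA, hdeg⟩ := h.exists_one_le hNo hx hzN
  rw [← (hN w hwN).2]
  exact hdeg.trans (h.brouwerDeg_le hAU hAo hwA (hN w hwN).1)

theorem frequently_notMem (hint : interior (y '' frontier U) = ∅)
    (z : EuclideanSpace ℝ (Fin d)) : ∃ᶠ w in 𝓝 z, w ∉ y '' frontier U :=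
  mem_closure_iff_frequently.1 ((interior_eq_empty_iff_dense_compl.1 hint) z)

/-- Comparison with `U` needs a value off `y '' frontier U`. Such values exist arbitrarily close to
`z`, and a small move does not change the degree on `A`. -/
theorem le_one (h : PositiveDegreeOn y U) (hint : interior (y '' frontier U) = ∅)
    (hle : ∀ z, z ∉ y '' frontier U → brouwerDeg y U z ≤ 1) (hAU : A ⊆ U) (hA : IsOpen A)
    (hzA : z ∉ y '' frontier A) : brouwerDeg y A z ≤ 1 := by
  obtain ⟨w, hw, hw', hdeg⟩ :=
    ((frequently_notMem hint z).and_eventually ((h.mono hAU hA).eventually_eq hzA)).exists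
  rw [← hdeg]
  exact (h.brouwerDeg_le hAU hA hw' hw).trans (hle w hw)

/-- After moving `z` off `y '' frontier U`, additivity and monotonicity give degree at least 2 on
`U`. -/
theorem false_of_disjoint (h : PositiveDegreeOn y U) (hint : interior (y '' frontier U) = ∅)
    (hle : ∀ z, z ∉ y '' frontier U → brouwerDeg y U z ≤ 1) (hAU : A ⊆ U) (hA : IsOpen A)
    (hBU : B ⊆ U) (hB : IsOpen B) (hAB : Disjoint A B) (hzA : z ∉ y '' frontier A)
    (hzB : z ∉ y '' frontier B) (hdA : 1 ≤ brouwerDeg y A z) (hdB : 1 ≤ brouwerDeg y B z) :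
    False := by
  obtain ⟨w, hw, ⟨hwA, hdegA⟩, hwB, hdegB⟩ := ((frequently_notMem hint z).and_eventually
    (((h.mono hAU hA).eventually_eq hzA).and ((h.mono hBU hB).eventually_eq hzB))).exists
  have hBsub : B ⊆ U \ closure A := fun x hx =>
    ⟨hBU hx, fun hx' => (hAB.closure_left hB).le_bot ⟨hx', hx⟩⟩
  have h1 := (h.mono (A := U \ closure A) sdiff_subset
    (h.isOpen.sdiff isClosed_closure)).brouwerDeg_le hBsub hB hwB
    (notMem_image_frontier_sdiff h.isOpen hA hwA hw)
  have h2 := h.add_sdiff_eq hAU hA hwA hw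
  linarith [hle w hw]

/-- Compact sets with empty interior are mapped to sets with empty interior. -/
theorem interior_image_eq_empty (h : PositiveDegreeOn y U)
    (hint : interior (y '' frontier U) = ∅)
    (hle : ∀ z, z ∉ y '' frontier U → brouwerDeg y U z ≤ 1)
    {K : Set (EuclideanSpace ℝ (Fin d))} (hK : IsCompact K) (hKU : K ⊆ closure U)
    (hKint : interior K = ∅) : interior (y '' K) = ∅ := by
  by_contra hne
  set N := interior (y '' K) with hN
  have hmem : ∀ w ∈ N, w ∉ y '' frontier U → ∃ k ∈ K, k ∈ U ∧ y k = w := by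
    intro w hw hw'
    obtain ⟨k, hk, rfl⟩ := interior_subset hw
    refine ⟨k, hk, ?_, rfl⟩
    by_contra hkU
    exact hw' ⟨k, h.isOpen.frontier_eq ▸ ⟨hKU hk, hkU⟩, rfl⟩
  obtain ⟨v, hv⟩ := nonempty_iff_ne_empty.2 hne
  obtain ⟨w, hw, hwN⟩ := ((frequently_notMem hint v).and_eventually
    (isOpen_interior.mem_nhds hv)).exists
  obtain ⟨k, -, hkU, rfl⟩ := hmem w hwN hw
  have hVo : IsOpen (U ∩ y ⁻¹' N) :=
    (h.continuousOn.mono subset_closure).isOpen_inter_preimage h.isOpen isOpen_interior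
  obtain ⟨x, hxV, hxK⟩ : ((U ∩ y ⁻¹' N) \ K).Nonempty := by
    rw [sdiff_nonempty]
    intro hsub
    exact (hKint ▸ interior_maximal hsub hVo ⟨hkU, hwN⟩ : k ∈ (∅ : Set _))
  -- Working in `U \ K` keeps `A` away from `K`.
  have hV := h.mono (A := U \ K) sdiff_subset (h.isOpen.sdiff hK.isClosed)
  obtain ⟨A, hA, hAo, u, huN, huA, hdeg⟩ := hV.exists_one_le isOpen_interior ⟨hxV.1, hxK⟩ hxV.2
  have hAU := hA.trans sdiff_subset
  -- The perturbed value stays in `N`, hence is attained at some `k ∈ K`. This `k` is neither in `A`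
  -- nor on its frontier, so `U \ closure A` attains the value as well.
  obtain ⟨w, hw, hwN, hwA, hdegw⟩ := ((frequently_notMem hint u).and_eventually
    ((isOpen_interior.eventually_mem huN).and ((h.mono hAU hAo).eventually_eq huA))).exists
  obtain ⟨k, hkK, hkU, rfl⟩ := hmem w hwN hw
  have hB := h.mono (A := U \ closure A) sdiff_subset (h.isOpen.sdiff isClosed_closure)
  have hwB := notMem_image_frontier_sdiff h.isOpen hAo hwA hw
  refine h.false_of_disjoint hint hle hAU hAo sdiff_subset hB.isOpen
    (disjoint_left.2 fun x hx hx' => hx'.2 (subset_closure hx)) hwA hwB (hdegw ▸ hdeg)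
    (hB.one_le hwB ⟨k, ⟨hkU, fun hkA => hwA ⟨k, hAo.frontier_eq ▸ ⟨hkA, fun hk => ?_⟩, rfl⟩⟩, rfl⟩)
  exact (hA hk).2 hkK

/-- Values of nonzero degree on an open subset of `V` are not attained on the boundary of `V`. -/
theorem notMem_image_frontier (h : PositiveDegreeOn y U) (hint : interior (y '' frontier U) = ∅)
    (hle : ∀ z, z ∉ y '' frontier U → brouwerDeg y U z ≤ 1)
    {V : Set (EuclideanSpace ℝ (Fin d))} (hVU : V ⊆ U) (hV : IsOpen V) (hAV : A ⊆ V)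
    (hA : IsOpen A) (hzA : z ∉ y '' frontier A) (hdeg : 1 ≤ brouwerDeg y A z) :
    z ∉ y '' frontier V := by
  rintro ⟨w, hw, rfl⟩
  obtain ⟨N, hN, hNo, hwN⟩ := _root_.eventually_nhds_iff.1
    ((h.mono (hAV.trans hVU) hA).eventually_eq hzA)
  -- Hence points of `V` near `w` stay outside `closure A` while their values approach `y w`.
  have hwA : w ∈ (closure A)ᶜ := fun hwA => hzA ⟨w, hA.frontier_eq ▸ ⟨hwA, fun hw' =>
    (hV.frontier_eq ▸ hw).2 (hAV hw')⟩, rfl⟩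
  have hwV : w ∈ closure V := frontier_subset_closure hw
  have hnear : ∀ᶠ x in 𝓝[V] w, y x ∈ N ∧ x ∈ (closure A)ᶜ ∧ x ∈ V := by
    refine Eventually.and ?_ (Eventually.and ?_ self_mem_nhdsWithin)
    · exact ((h.continuousOn.mono (closure_mono hVU) w hwV).mono subset_closure).eventually
        (hNo.mem_nhds hwN)
    · exact mem_nhdsWithin_of_mem_nhds (isClosed_closure.isOpen_compl.mem_nhds hwA)
  have := mem_closure_iff_nhdsWithin_neBot.1 hwV
  obtain ⟨x, hxN, hxA, hxV⟩ := hnear.exists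
  have hW := h.mono (A := V \ closure A) (sdiff_subset.trans hVU) (hV.sdiff isClosed_closure)
  obtain ⟨B, hB, hBo, u, huN, huB, hdegB⟩ := hW.exists_one_le hNo ⟨hxV, hxA⟩ hxN
  exact h.false_of_disjoint hint hle (hAV.trans hVU) hA (hB.trans (sdiff_subset.trans hVU)) hBo
    (disjoint_left.2 fun x hx hx' => (hB hx').2 (subset_closure hx)) (hN u huN).1 huB
    ((hN u huN).2 ▸ hdeg) hdegB

/-- The image of the boundary is the boundary of the image, if it has empty interior. -/
theorem image_frontier_eq (h : PositiveDegreeOn y U) (hint : interior (y '' frontier U) = ∅) :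
    y '' frontier U = frontier (y '' U \ y '' frontier U) := by
  have hfr : IsCompact (y '' frontier U) :=
    (isCompact_frontier_of_isBounded h.isBounded).image_of_continuousOn
      (h.continuousOn.mono frontier_subset_closure)
  have hopen : IsOpen (y '' U \ y '' frontier U) := by
    rw [isOpen_iff_mem_nhds]
    rintro z ⟨hz, hz'⟩
    filter_upwards [h.eventually_eq hz'] with w hw
    refine ⟨h.mem_image hw.1 ?_, hw.1⟩
    have := h.one_le hz' hz
    rw [hw.2]
    omega
  rw [hopen.frontier_eq]
  refine Subset.antisymm ?_ ?_
  · rintro _ ⟨w, hw, rfl⟩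
    refine ⟨?_, fun h' => h'.2 ⟨w, hw, rfl⟩⟩
    rw [_root_.mem_closure_iff]
    intro N hNo hwN
    have hwU : w ∈ closure U := frontier_subset_closure hw
    have := mem_closure_iff_nhdsWithin_neBot.1 hwU
    obtain ⟨x, hxN, hxU⟩ := ((((h.continuousOn w hwU).mono subset_closure).eventually
      (hNo.mem_nhds hwN)).and (self_mem_nhdsWithin (a := w) (s := U))).exists
    -- A value of positive degree can be moved off `y '' frontier U` and is still attained, as its
    -- degree stays nonzero.
    obtain ⟨A, hAU, hAo, u, huN, huA, hdeg⟩ := h.exists_one_le hNo hxU hxN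
    obtain ⟨v, hv, hvN, hvA, hdegv⟩ := ((frequently_notMem hint u).and_eventually
      ((hNo.eventually_mem huN).and ((h.mono hAU hAo).eventually_eq huA))).exists
    exact ⟨v, hvN, image_mono hAU ((h.mono hAU hAo).mem_image hvA (by omega)), hv⟩
  · rintro z ⟨hz, hz'⟩
    have hcl : z ∈ y '' closure U := by
      refine closure_minimal (fun w hw => image_mono subset_closure hw.1)
        (h.isBounded.isCompact_closure.image_of_continuousOn h.continuousOn).isClosed hz
    by_contra hcon
    obtain ⟨x, hx, rfl⟩ := hcl
    refine hz' ⟨⟨x, ?_, rfl⟩, hcon⟩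
    by_contra hxU
    exact hcon ⟨x, h.isOpen.frontier_eq ▸ ⟨hx, hxU⟩, rfl⟩

end PositiveDegreeOn

/-! ### From strict orientation preservation to the theorem -/

theorem StrictlyOrientationPreserving.positiveDegreeOn {d : ℕ}
    {Ω U : Set (EuclideanSpace ℝ (Fin d))}
    {y : EuclideanSpace ℝ (Fin d) → EuclideanSpace ℝ (Fin d)}
    (h : StrictlyOrientationPreserving Ω y) (hUΩ : U ⊆ Ω) (hU : IsOpen U)
    (hb : Bornology.IsBounded U) (hy : ContinuousOn y (closure U)) : PositiveDegreeOn y U where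
  isOpen := hU
  isBounded := hb
  continuousOn := hy
  nonneg A hA hAo z hz := by
    obtain ⟨B, hBo, hBc, hBA, hzB, -, hdeg⟩ := exists_compactly_contained_brouwerDeg_eq
      (hb.subset hA) hAo (hy.mono (closure_mono hA)) hz
    rw [hdeg]
    exact h.2 B ⟨hBo, hBc, hBA.trans (hA.trans hUΩ)⟩ z hzB
  nondegenerate V hV hVo hne := by
    obtain ⟨x, hx⟩ := hne
    obtain ⟨r, hr, hball⟩ := Metric.nhds_basis_closedBall.mem_iff.1 (hVo.mem_nhds hx)
    have hcl : closure (ball x r) ⊆ closedBall x r := closure_ball_subset_closedBall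
    obtain ⟨A, hA, hAsub, z, hz, hdeg⟩ := h.1 (ball x r) ⟨isOpen_ball,
      (isCompact_closedBall x r).of_isClosed_subset isClosed_closure hcl,
      hcl.trans (hball.trans (hV.trans hUΩ))⟩ ⟨x, mem_ball_self hr⟩
    exact ⟨A, hAsub.trans (ball_subset_closedBall.trans hball), hA.1, z, hz, hdeg⟩

theorem corollary5p9 {d : ℕ} (hd : 2 ≤ d)
    (Ω : Set (EuclideanSpace ℝ (Fin d))) (hΩ : IsOpen Ω)
    (y : EuclideanSpace ℝ (Fin d) → EuclideanSpace ℝ (Fin d)) (hy : ContinuousOn y Ω)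
    (hsop : StrictlyOrientationPreserving Ω y)
    (U : Set (EuclideanSpace ℝ (Fin d)))
    -- either `U` is open and compactly contained in `Ω`,
    -- or `U = Ω` is bounded and `y` is continuous up to the boundary
    (hU : U ∈ openCC Ω ∨
      (U = Ω ∧ Bornology.IsBounded Ω ∧ ContinuousOn y (closure Ω)))
    (hdeg : ∀ z, z ∉ y '' frontier U → brouwerDeg y U z ≤ 1)
    (hint : interior (y '' frontier U) = ∅) :
    (∀ K : Set (EuclideanSpace ℝ (Fin d)), IsCompact K → K ⊆ closure U →
      interior K = ∅ → interior (y '' K) = ∅) ∧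
    (∀ U' : Set (EuclideanSpace ℝ (Fin d)), IsOpen U' → Bornology.IsBounded U' → U' ⊆ U →
      interior (frontier U') = ∅ →
      -- the image of the boundary of `U'` has empty interior
      interior (y '' frontier U') = ∅ ∧
      -- part (i)
      (∀ A ∈ openCC Ω, A ⊆ U' →
        (∀ z ∈ y '' A \ y '' frontier A, 1 ≤ brouwerDeg y A z) ∧
        (∀ z ∈ y '' A \ (y '' frontier A ∪ y '' frontier U'), brouwerDeg y A z ≤ 1) ∧
        (∀ z ∈ y '' A \ y '' frontier A, brouwerDeg y A z = 1)) ∧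
      -- part (iii)
      imLoc Ω y U' ∩ y '' frontier U' = ∅ ∧
      reducedDomain Ω y U' = U' \ y ⁻¹' (y '' frontier U') ∧
      imLoc Ω y U' = y '' U' \ y '' frontier U' ∧
      y '' U' \ y '' frontier U' = imT y U' ∧
      y '' frontier U' = frontier (imLoc Ω y U')) := by
  have hUΩ : U ⊆ Ω := hU.elim (fun h => subset_closure.trans h.2.2) fun h => h.1.le
  have hpos : PositiveDegreeOn y U := by
    rcases hU with h | ⟨rfl, hb, hyc⟩
    · exact hsop.positiveDegreeOn hUΩ h.1 (h.2.1.isBounded.subset subset_closure) (hy.mono h.2.2)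
    · exact hsop.positiveDegreeOn hUΩ hΩ hb hyc
  refine ⟨fun K hK hKU => hpos.interior_image_eq_empty hint hdeg hK hKU, ?_⟩
  intro V hVo hVb hVU hVint
  have hV := hpos.mono hVU hVo
  have hVfr : interior (y '' frontier V) = ∅ := hpos.interior_image_eq_empty hint hdeg
    (isCompact_frontier_of_isBounded hVb) (frontier_subset_closure.trans (closure_mono hVU)) hVint
  have hone : ∀ A, IsOpen A → A ⊆ V → ∀ z ∈ y '' A \ y '' frontier A, 1 ≤ brouwerDeg y A z :=
    fun A hA hAV z hz => (hV.mono hAV hA).one_le hz.2 hz.1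
  have hleone : ∀ A, IsOpen A → A ⊆ V → ∀ z ∉ y '' frontier A, brouwerDeg y A z ≤ 1 :=
    fun A hA hAV z hz => hpos.le_one hint hdeg (hAV.trans hVU) hA hz
  -- The substantial inclusion of part (iii); the converse only shrinks `V` around all solutions, as
  -- in `hexists`.
  have hnot : ∀ A, IsOpen A → A ⊆ V → ∀ z ∈ y '' A \ y '' frontier A, z ∉ y '' frontier V :=
    fun A hA hAV z hz => hpos.notMem_image_frontier hint hdeg hVU hVo hAV hA hz.2
      (hone A hA hAV z hz)
  have hexists : ∀ x ∈ V, y x ∉ y '' frontier V →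
      ∃ A ∈ openCC Ω, x ∈ A ∧ A ⊆ V ∧ y x ∉ y '' frontier A := by
    intro x hx hxV
    obtain ⟨A, hAo, hAc, hAV, hzA, hsol, -⟩ := exists_compactly_contained_brouwerDeg_eq
      hVb hVo hV.continuousOn hxV
    exact ⟨A, ⟨hAo, hAc, hAV.trans (hVU.trans hUΩ)⟩, hsol x hx rfl, subset_closure.trans hAV, hzA⟩
  have himT : ∀ A, IsOpen A → A ⊆ V → imT y A = y '' A \ y '' frontier A := by
    intro A hA hAV
    ext z
    refine ⟨fun hz => ⟨(hV.mono hAV hA).mem_image hz.1 hz.2, hz.1⟩, fun hz => ⟨hz.2, ?_⟩⟩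
    have := hone A hA hAV z hz
    omega
  have hloc : imLoc Ω y V = y '' V \ y '' frontier V := by
    ext z
    constructor
    · rintro ⟨A, hA, hAV, hz⟩
      rw [himT A hA.1 hAV] at hz
      exact ⟨image_mono hAV hz.1, hnot A hA.1 hAV z hz⟩
    · rintro ⟨⟨x, hx, rfl⟩, hz⟩
      obtain ⟨A, hA, hxA, hAV, hzA⟩ := hexists x hx hz
      exact ⟨A, hA, hAV, himT A hA.1 hAV ▸ ⟨⟨x, hxA, rfl⟩, hzA⟩⟩
  refine ⟨hVfr, fun A hA hAV => ⟨hone A hA.1 hAV,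
    fun z hz => hleone A hA.1 hAV z fun h => hz.2 (Or.inl h),
    fun z hz => le_antisymm (hleone A hA.1 hAV z hz.2) (hone A hA.1 hAV z hz)⟩, ?_, ?_, hloc,
    (himT V hVo subset_rfl).symm, ?_⟩
  · rw [hloc]
    exact sdiff_inter_self
  · ext x
    constructor
    · rintro ⟨hx, A, hA, hxA, hAV, hzA⟩
      exact ⟨hx, hnot A hA.1 hAV (y x) ⟨⟨x, hxA, rfl⟩, hzA⟩⟩
    · rintro ⟨hx, hxV⟩
      exact ⟨hx, hexists x hx hxV⟩
  · rw [hloc]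
    exact hV.image_frontier_eq hVfr
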